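/- Let $X$ and $Y$ be Banach spaces over $\mathbb{K}\in\{\mathbb{R},\mathbb{C}\}$; operators are bounded linear maps, and $\mathscr{B}(X,Y)$ is the set of operators from $X$ to $Y$. An operator $T\in\mathscr{B}(X,Y)$ is Fredholm if $\dim\ker T$ and $\dim Y/\operatorname{ran}T$ are finite, and its index is then $\dim\ker T-\dim Y/\operatorname{ran}T\in\mathbb{Z}$; it is inessential if $I_X-ST$ is Fredholm for every $S\in\mathscr{B}(Y,X)$. A set $\Sigma\subseteq\mathscr{B}(X,Y)$ is essentially closed under addition if for all $U,V\in\Sigma$ there is an inessential $R\in\mathscr{B}(X,Y)$ such that $U+V-R\in\Sigma$. (These definitions also apply to any other pair of Banach spaces in place of $X$, $Y$.) Put $\mathscr{G}_Y(X)=\{ST: S\in\mathscr{B}(Y,X),\ T\in\mathscr{B}(X,Y)\}$ and $\mathscr{G}_X(Y)=\{TS: S\in\mathscr{B}(Y,X),\ T\in\mathscr{B}(X,Y)\}$. Operators $U\in\mathscr{B}(X,X)$ and $V\in\mathscr{B}(Y,Y)$ are Schur coupled if there are isomorphisms $A\in\mathscr{B}(X,X)$, $D\in\mathscr{B}(Y,Y)$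 and operators $B\in\mathscr{B}(Y,X)$, $C\in\mathscr{B}(X,Y)$ with $U=A-BD^{-1}C$ and $V=D-CA^{-1}B$. Let $\mathbb{I}_{\mathrm{SC}}(X,Y)$ be the set of $k\in\mathbb{Z}$ for which there exist Schur coupled Fredholm operators $U\in\mathscr{B}(X,X)$ and $V\in\mathscr{B}(Y,Y)$, both of index $k$, and let $\operatorname{sc}(X,Y)$ be the least positive element of $\mathbb{I}_{\mathrm{SC}}(X,Y)$, or $0$ if there is none. Suppose that at least one of the sets $\mathscr{G}_Y(X)$ and $\mathscr{G}_X(Y)$ is essentially closed under addition. Then $\mathbb{I}_{\mathrm{SC}}(X,Y)$ is closed under addition, and $\mathbb{I}_{\mathrm{SC}}(X,Y)=\operatorname{sc}(X,Y)\,\mathbb{Z}$. -/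

import Mathlib

/-- A bounded operator between real or complex Banach spaces is Fredholm in the sense of Mathlib if
and only if its kernel and its cokernel are finite-dimensional. -/
theorem isFredholm_iff_finiteDimensional {𝕜 X Y : Type*} [RCLike 𝕜]
    [NormedAddCommGroup X] [NormedSpace 𝕜 X] [CompleteSpace X]
    [NormedAddCommGroup Y] [NormedSpace 𝕜 Y] [CompleteSpace Y] (T : X →L[𝕜] Y) :
    T.IsFredholm ↔
      FiniteDimensional 𝕜 (T : X →ₗ[𝕜] Y).ker ∧
        FiniteDimensional 𝕜 (Y ⧸ (T : X →ₗ[𝕜] Y).range) := by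
  refine ⟨fun h => ⟨h.finite_ker, h.finite_coker⟩, fun ⟨hk, hc⟩ => ?_⟩
  have hkc : (T : X →ₗ[𝕜] Y).ker.ClosedComplemented :=
    Submodule.ClosedComplemented.of_finiteDimensional _
  obtain ⟨q, hq, hcompl⟩ := hkc.exists_isClosed_isCompl
  obtain ⟨G, hG⟩ := (T : X →ₗ[𝕜] Y).range.exists_isCompl
  have : FiniteDimensional 𝕜 G :=
    Module.Finite.equiv (Submodule.quotientEquivOfIsCompl _ G hG)
  have : CompleteSpace q := hq.completeSpace_coe
  have hr : ((T.comp q.subtypeL : q →L[𝕜] Y) : q →ₗ[𝕜] Y).range = (T : X →ₗ[𝕜] Y).range := by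
    refine le_antisymm ?_ ?_
    · rintro _ ⟨x, rfl⟩
      exact ⟨x, rfl⟩
    · rintro _ ⟨x, rfl⟩
      obtain ⟨a, ha, b, hb, rfl⟩ := Submodule.mem_sup.1
        (hcompl.sup_eq_top ▸ Submodule.mem_top : x ∈ (T : X →ₗ[𝕜] Y).ker ⊔ q)
      refine ⟨⟨b, hb⟩, ?_⟩
      have : T a = 0 := ha
      simp [this]
  have hclosed : IsClosed ((T : X →ₗ[𝕜] Y).range : Set Y) := by
    rw [← hr]
    refine ContinuousLinearMap.closed_complemented_range_of_isCompl_of_ker_eq_bot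
      (T.comp q.subtypeL) G (hr ▸ hG) (Submodule.closed_of_finiteDimensional G) ?_
    rw [Submodule.eq_bot_iff]
    intro x hx
    have h1 : (x : X) ∈ (T : X →ₗ[𝕜] Y).ker := hx
    have h2 := hcompl.disjoint.le_bot (show (x : X) ∈ (T : X →ₗ[𝕜] Y).ker ⊓ q from ⟨h1, x.2⟩)
    exact Subtype.ext h2
  have : CompleteSpace (T : X →ₗ[𝕜] Y).range := hclosed.completeSpace_coe
  refine ⟨?_, hclosed, hk, hc, hkc⟩
  have hsurj : Function.Surjective T.rangeRestrict := by
    rintro ⟨_, x, rfl⟩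
    exact ⟨x, rfl⟩
  exact (T.rangeRestrict.isOpenMap hsurj).isQuotientMap T.rangeRestrict.continuous hsurj

section Operators

variable {𝕜 X Y : Type*} [RCLike 𝕜] [NormedAddCommGroup X] [NormedSpace 𝕜 X]
  [NormedAddCommGroup Y] [NormedSpace 𝕜 Y]

/-- `Φ_k(X, Y)`: the Fredholm operators `T : X → Y` of index `dim ker T - dim Y / ran T = k`. -/
def FredholmOfIndex (𝕜 X Y : Type*) [RCLike 𝕜] [NormedAddCommGroup X] [NormedSpace 𝕜 X]
    [NormedAddCommGroup Y] [NormedSpace 𝕜 Y] (k : ℤ) : Set (X →L[𝕜] Y) :=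
  {T | T.IsFredholm ∧ (T : X →ₗ[𝕜] Y).index = k}

/-- `T : X → Y` is inessential if `I - S T` is Fredholm for every operator `S : Y → X`. -/
def IsInessential (T : X →L[𝕜] Y) : Prop :=
  ∀ S : Y →L[𝕜] X, (ContinuousLinearMap.id 𝕜 X - S ∘L T).IsFredholm

/-- A set of operators is essentially closed under addition if, up to an inessential operator, it
contains the sum of any two of its members. -/
def EssentiallyClosedUnderAddition (s : Set (X →L[𝕜] Y)) : Prop :=
  ∀ U ∈ s, ∀ V ∈ s, ∃ R : X →L[𝕜] Y, IsInessential R ∧ U + V - R ∈ s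

/-- `G_Y(X)`: the operators on `X` that factor through `Y`. -/
def FactoringThrough (𝕜 Y X : Type*) [RCLike 𝕜] [NormedAddCommGroup X] [NormedSpace 𝕜 X]
    [NormedAddCommGroup Y] [NormedSpace 𝕜 Y] : Set (X →L[𝕜] X) :=
  {W | ∃ (S : Y →L[𝕜] X) (T : X →L[𝕜] Y), W = S ∘L T}

/-- `U` and `V` are Schur coupled: `U = A - B D⁻¹ C` and `V = D - C A⁻¹ B` for some operators
`B`, `C` and isomorphisms `A`, `D`. -/
def SchurCoupled (U : X →L[𝕜] X) (V : Y →L[𝕜] Y) : Prop :=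
  ∃ (A : X ≃L[𝕜] X) (D : Y ≃L[𝕜] Y) (B : Y →L[𝕜] X) (C : X →L[𝕜] Y),
    U = (A : X →L[𝕜] X) - B ∘L (D.symm : Y →L[𝕜] Y) ∘L C ∧
    V = (D : Y →L[𝕜] Y) - C ∘L (A.symm : X →L[𝕜] X) ∘L B

/-- `SC_k(X, Y)`: the Schur coupled pairs of Fredholm operators of index `k` on `X` and `Y`. -/
def SchurCoupledPairs (𝕜 X Y : Type*) [RCLike 𝕜] [NormedAddCommGroup X] [NormedSpace 𝕜 X]
    [NormedAddCommGroup Y] [NormedSpace 𝕜 Y] (k : ℤ) : Set ((X →L[𝕜] X) × (Y →L[𝕜] Y)) :=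
  {p | p.1 ∈ FredholmOfIndex 𝕜 X X k ∧ p.2 ∈ FredholmOfIndex 𝕜 Y Y k ∧ SchurCoupled p.1 p.2}

/-- `I_SC(X, Y)`: the integers `k` such that `SC_k(X, Y)` is non-empty. -/
def schurIndexSet (𝕜 X Y : Type*) [RCLike 𝕜] [NormedAddCommGroup X] [NormedSpace 𝕜 X]
    [NormedAddCommGroup Y] [NormedSpace 𝕜 Y] : Set ℤ :=
  {k | (SchurCoupledPairs 𝕜 X Y k).Nonempty}

open Classical in
/-- `sc(X, Y)`: the least positive element of `I_SC(X, Y)`, or `0` if there is none. -/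
noncomputable def schurIndex (𝕜 X Y : Type*) [RCLike 𝕜] [NormedAddCommGroup X] [NormedSpace 𝕜 X]
    [NormedAddCommGroup Y] [NormedSpace 𝕜 Y] : ℕ :=
  if h : ∃ n : ℕ, 0 < n ∧ (n : ℤ) ∈ schurIndexSet 𝕜 X Y then Nat.find h else 0

end Operators

/-! Schur coupling drops out: `k` lies in `schurIndexSet 𝕜 X Y` iff `I - W` is Fredholm of index `k`
for some `W` factoring through `Y` (`mem_schurIndexSet_iff`). This set of indices is always
symmetric: modulo finite rank (the relation `≈`), a quasi-inverse `P` of `I - ST` equals `I + PST`.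
For sums, `(I - W₁)(I - W₂) = I - (W₁(I - W₂) + W₂)`, and the hypothesis puts the bracket back into
the factoring operators up to an inessential operator, which does not affect the index
(`FredholmOfIndex.add_inessential`). Hence the set is a subgroup of `ℤ`. -/

open LinearMap.FiniteRangeSetoid

/-! ### Algebra of the index -/

section Algebra

variable {K V W : Type*} [Field K] [AddCommGroup V] [Module K V] [AddCommGroup W] [Module K W]

/-- The index is unchanged by finite rank perturbations. -/
theorem LinearMap.index_eq_of_equiv {f g : V →ₗ[K] W} (h : f ≈ g)
    [FiniteDimensional K f.ker] [FiniteDimensional K (W ⧸ f.range)]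
    [FiniteDimensional K g.ker] [FiniteDimensional K (W ⧸ g.range)] : f.index = g.index := by
  -- `f` and `g` agree on `L`, which has finite codimension; restricting to `L` shifts both indices
  -- by the index of the inclusion.
  set L : Submodule K V := LinearMap.eqLocus f g
  have hL : IsNoetherian K (V ⧸ L) := equiv_iff_isNoetherian_quotient_eqLocus.1 h
  have hker : FiniteDimensional K L.subtype.ker := by rw [L.ker_subtype]; infer_instance
  have hcoker : FiniteDimensional K (V ⧸ L.subtype.range) := by
    rw [L.range_subtype]; infer_instance
  have hfg : f ∘ₗ L.subtype = g ∘ₗ L.subtype := LinearMap.ext fun x => x.2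
  have hf := LinearMap.index_comp (f := L.subtype) f
  have hg := LinearMap.index_comp (f := L.subtype) g
  rw [hfg] at hf
  lia

variable (S : W →ₗ[K] V) (T : V →ₗ[K] W)

/-- The kernels of `1 - S T` and `1 - T S` are isomorphic. -/
def LinearMap.kerOneSubCompEquiv :
    (LinearMap.id - S ∘ₗ T).ker ≃ₗ[K] (LinearMap.id - T ∘ₗ S).ker :=
  LinearEquiv.ofLinearMap
    (T.restrict fun x hx => by
      have hx' : x = S (T x) := by simpa [sub_eq_zero] using hx
      simp [← hx'])
    (S.restrict fun y hy => by
      have hy' : y = T (S y) := by simpa [sub_eq_zero] using hy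
      simp [← hy'])
    (by
      ext ⟨y, hy⟩
      have hy' : y = T (S y) := by simpa [sub_eq_zero] using hy
      simp [← hy'])
    (by
      ext ⟨x, hx⟩
      have hx' : x = S (T x) := by simpa [sub_eq_zero] using hx
      simp [← hx'])

/-- The cokernels of `1 - S T` and `1 - T S` are isomorphic. -/
def LinearMap.cokerOneSubCompEquiv :
    (V ⧸ (LinearMap.id - S ∘ₗ T).range) ≃ₗ[K] (W ⧸ (LinearMap.id - T ∘ₗ S).range) :=
  LinearEquiv.ofLinearMap
    (Submodule.mapQ _ _ T (by rintro _ ⟨x, rfl⟩; exact ⟨T x, by simp⟩))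
    (Submodule.mapQ _ _ S (by rintro _ ⟨y, rfl⟩; exact ⟨S y, by simp⟩))
    (by
      ext y
      refine (Submodule.Quotient.eq _).2 ⟨-y, ?_⟩
      simp [neg_add_eq_sub])
    (by
      ext x
      refine (Submodule.Quotient.eq _).2 ⟨-x, ?_⟩
      simp [neg_add_eq_sub])

theorem LinearMap.index_one_sub_comp_comm :
    (LinearMap.id - S ∘ₗ T).index = (LinearMap.id - T ∘ₗ S).index := by
  rw [LinearMap.index_eq_finrank_sub, LinearMap.index_eq_finrank_sub,
    (LinearMap.kerOneSubCompEquiv S T).finrank_eq, (LinearMap.cokerOneSubCompEquiv S T).finrank_eq]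

end Algebra

/-! ### Fredholm operators and their perturbations -/

section Fredholm

open ContinuousLinearMap

variable {𝕜 X Y Z : Type*} [RCLike 𝕜]
  [NormedAddCommGroup X] [NormedSpace 𝕜 X] [NormedAddCommGroup Y] [NormedSpace 𝕜 Y]
  [NormedAddCommGroup Z] [NormedSpace 𝕜 Z]

theorem ContinuousLinearMap.IsFredholm.of_equiv {T T' : X →L[𝕜] Y} (hT : T.IsFredholm)
    (h : (T' : X →ₗ[𝕜] Y) ≈ T) : T'.IsFredholm := by
  obtain ⟨v, hv⟩ := hT.exists_isQuasiInverse
  exact .of_isQuasiInverse (hv.congr (Setoid.refl _) h)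

theorem ContinuousLinearMap.IsFredholm.index_eq_of_equiv {T T' : X →L[𝕜] Y} (hT : T.IsFredholm)
    (h : (T' : X →ₗ[𝕜] Y) ≈ T) : (T' : X →ₗ[𝕜] Y).index = (T : X →ₗ[𝕜] Y).index := by
  have hT' := hT.of_equiv h
  have := hT.finite_ker
  have := hT'.finite_ker
  have : FiniteDimensional 𝕜 (Y ⧸ (T : X →ₗ[𝕜] Y).range) := hT.finite_coker
  have : FiniteDimensional 𝕜 (Y ⧸ (T' : X →ₗ[𝕜] Y).range) := hT'.finite_coker
  exact LinearMap.index_eq_of_equiv h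

theorem ContinuousLinearMap.IsFredholm.comp {T : X →L[𝕜] Y} {U : Y →L[𝕜] Z} (hU : U.IsFredholm)
    (hT : T.IsFredholm) : (U ∘L T).IsFredholm := by
  obtain ⟨v, hv⟩ := hT.exists_isQuasiInverse
  obtain ⟨w, hw⟩ := hU.exists_isQuasiInverse
  exact .of_isQuasiInverse (v := v ∘L w) (hv.comp hw)

theorem ContinuousLinearMap.IsFredholm.index_comp {T : X →L[𝕜] Y} {U : Y →L[𝕜] Z}
    (hU : U.IsFredholm) (hT : T.IsFredholm) :
    ((U ∘L T : X →L[𝕜] Z) : X →ₗ[𝕜] Z).index =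
      (U : Y →ₗ[𝕜] Z).index + (T : X →ₗ[𝕜] Y).index := by
  have := hT.finite_ker
  have := hU.finite_ker
  have : FiniteDimensional 𝕜 (Y ⧸ (T : X →ₗ[𝕜] Y).range) := hT.finite_coker
  have : FiniteDimensional 𝕜 (Z ⧸ (U : Y →ₗ[𝕜] Z).range) := hU.finite_coker
  exact LinearMap.index_comp (f := (T : X →ₗ[𝕜] Y)) (U : Y →ₗ[𝕜] Z)

theorem ContinuousLinearEquiv.isFredholm (e : X ≃L[𝕜] Y) : (e : X →L[𝕜] Y).IsFredholm :=
  .of_isQuasiInverse (v := (e.symm : Y →L[𝕜] X)) e.toLinearEquiv.isQuasiInverse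

theorem ContinuousLinearEquiv.index_eq_zero (e : X ≃L[𝕜] Y) :
    ((e : X →L[𝕜] Y) : X →ₗ[𝕜] Y).index = 0 :=
  LinearEquiv.index_eq_zero (e := e.toLinearEquiv)

/-- Left and right invertibility modulo operators of finite rank imply that `T` is Fredholm. -/
theorem ContinuousLinearMap.IsFredholm.of_left_of_right {T : X →L[𝕜] Y} {L R : Y →L[𝕜] X}
    (hL : (L : Y →ₗ[𝕜] X) ∘ₗ (T : X →ₗ[𝕜] Y) ≈ LinearMap.id)
    (hR : (T : X →ₗ[𝕜] Y) ∘ₗ (R : Y →ₗ[𝕜] X) ≈ LinearMap.id) : T.IsFredholm := by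
  refine .of_isQuasiInverse (v := L) ⟨hL, ?_⟩
  have hLR : (L : Y →ₗ[𝕜] X) ≈ R := calc
    (L : Y →ₗ[𝕜] X) ≈ (L : Y →ₗ[𝕜] X) ∘ₗ ((T : X →ₗ[𝕜] Y) ∘ₗ (R : Y →ₗ[𝕜] X)) :=
      Setoid.symm (equiv_comp_left hR)
    _ ≈ R := equiv_comp_right (u := (R : Y →ₗ[𝕜] X)) hL
  exact Setoid.trans (equiv_comp_left hLR) hR

theorem LinearMap.IsQuasiInverse.index_eq_neg {T : X →L[𝕜] Y} {P : Y →L[𝕜] X}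
    (h : (P : Y →ₗ[𝕜] X).IsQuasiInverse (T : X →ₗ[𝕜] Y)) :
    (P : Y →ₗ[𝕜] X).index = -(T : X →ₗ[𝕜] Y).index := by
  have hT : T.IsFredholm := .of_isQuasiInverse h
  have hP : P.IsFredholm := .of_isQuasiInverse h.symm
  have h1 := hP.index_comp hT
  have hid := (ContinuousLinearEquiv.refl 𝕜 X).isFredholm.index_eq_of_equiv (T' := P ∘L T) h.1
  rw [ContinuousLinearEquiv.index_eq_zero] at hid
  lia

/-- Applied with `P` a quasi-inverse of `T` and `Q` the identity, this turns a perturbation of `T`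
into one of the identity. -/
theorem LinearMap.equiv_comp_add {P : Y →L[𝕜] Z} {T E : X →L[𝕜] Y} {Q : X →L[𝕜] Z}
    (h : (P : Y →ₗ[𝕜] Z) ∘ₗ (T : X →ₗ[𝕜] Y) ≈ Q) :
    ((P ∘L (T + E) : X →L[𝕜] Z) : X →ₗ[𝕜] Z) ≈ ((Q + P ∘L E : X →L[𝕜] Z) : X →ₗ[𝕜] Z) := by
  rw [equiv_iff_hasNoetherianRange] at h ⊢
  convert h using 1
  ext x
  simp

theorem LinearMap.equiv_add_comp {P : X →L[𝕜] Y} {T E : Y →L[𝕜] Z} {Q : X →L[𝕜] Z}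
    (h : (T : Y →ₗ[𝕜] Z) ∘ₗ (P : X →ₗ[𝕜] Y) ≈ Q) :
    (((T + E) ∘L P : X →L[𝕜] Z) : X →ₗ[𝕜] Z) ≈ ((Q + E ∘L P : X →L[𝕜] Z) : X →ₗ[𝕜] Z) := by
  rw [equiv_iff_hasNoetherianRange] at h ⊢
  convert h using 1
  ext x
  simp

/-- Fredholm operators and their index are stable under small perturbations. -/
theorem ContinuousLinearMap.IsFredholm.eventually_index_eq [CompleteSpace X] [CompleteSpace Y]
    {T : X →L[𝕜] Y} (hT : T.IsFredholm) :
    ∀ᶠ U : X →L[𝕜] Y in nhds T,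
      U.IsFredholm ∧ (U : X →ₗ[𝕜] Y).index = (T : X →ₗ[𝕜] Y).index := by
  obtain ⟨P, hP⟩ := hT.exists_isQuasiInverse
  have hPF : P.IsFredholm := .of_isQuasiInverse hP.symm
  have hl : ∀ᶠ U : X →L[𝕜] Y in nhds T, IsUnit (1 + P ∘L (U - T) : X →L[𝕜] X) := by
    have hc : Continuous fun U : X →L[𝕜] Y => (1 + P ∘L (U - T) : X →L[𝕜] X) := by fun_prop
    exact hc.continuousAt.eventually (Units.isOpen.mem_nhds (by simp))
  have hr : ∀ᶠ U : X →L[𝕜] Y in nhds T, IsUnit (1 + (U - T) ∘L P : Y →L[𝕜] Y) := by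
    have hc : Continuous fun U : X →L[𝕜] Y => (1 + (U - T) ∘L P : Y →L[𝕜] Y) := by fun_prop
    exact hc.continuousAt.eventually (Units.isOpen.mem_nhds (by simp))
  filter_upwards [hl, hr] with U ⟨J, hJ⟩ ⟨J', hJ'⟩
  have h1 : ((P ∘L U : X →L[𝕜] X) : X →ₗ[𝕜] X) ≈ ((J : X →L[𝕜] X) : X →ₗ[𝕜] X) := by
    have := LinearMap.equiv_comp_add (E := U - T) (Q := (1 : X →L[𝕜] X)) hP.1
    rwa [add_sub_cancel, ← hJ] at this
  have h2 : ((U ∘L P : Y →L[𝕜] Y) : Y →ₗ[𝕜] Y) ≈ ((J' : Y →L[𝕜] Y) : Y →ₗ[𝕜] Y) := by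
    have := LinearMap.equiv_add_comp (E := U - T) (Q := (1 : Y →L[𝕜] Y)) hP.2
    rwa [add_sub_cancel, ← hJ'] at this
  have hU : U.IsFredholm := by
    refine .of_left_of_right (L := (↑J⁻¹ : X →L[𝕜] X) ∘L P) (R := P ∘L (↑J'⁻¹ : Y →L[𝕜] Y)) ?_ ?_
    · have := equiv_comp_left (u' := ((↑J⁻¹ : X →L[𝕜] X) : X →ₗ[𝕜] X)) h1
      have hj : ((↑J⁻¹ : X →L[𝕜] X) : X →ₗ[𝕜] X) ∘ₗ ((J : X →L[𝕜] X) : X →ₗ[𝕜] X) =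
          LinearMap.id := congrArg ContinuousLinearMap.toLinearMap J.inv_mul
      rwa [hj] at this
    · have := equiv_comp_right (u := ((↑J'⁻¹ : Y →L[𝕜] Y) : Y →ₗ[𝕜] Y)) h2
      have hj : ((J' : Y →L[𝕜] Y) : Y →ₗ[𝕜] Y) ∘ₗ ((↑J'⁻¹ : Y →L[𝕜] Y) : Y →ₗ[𝕜] Y) =
          LinearMap.id := congrArg ContinuousLinearMap.toLinearMap J'.mul_inv
      rwa [hj] at this
  refine ⟨hU, ?_⟩
  let e : X ≃L[𝕜] X := ContinuousLinearEquiv.ofUnit J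
  have h3 := e.isFredholm.index_eq_of_equiv h1
  rw [e.index_eq_zero, hPF.index_comp hU, hP.index_eq_neg] at h3
  lia

/-- Inessential perturbations of the identity have index zero. -/
theorem IsInessential.index_id_sub_comp [CompleteSpace X] {R : X →L[𝕜] Y} (hR : IsInessential R)
    (S : Y →L[𝕜] X) :
    ((ContinuousLinearMap.id 𝕜 X - S ∘L R : X →L[𝕜] X) : X →ₗ[𝕜] X).index = 0 := by
  -- A path from the identity that stays Fredholm because `S` is arbitrary in `IsInessential`; the
  -- locally constant index is constant along it.
  let f : ℝ → X →L[𝕜] X := fun t => ContinuousLinearMap.id 𝕜 X - ((t : 𝕜) • S) ∘L R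
  have hf : Continuous f := by
    have : Continuous fun t : ℝ => (t : 𝕜) := RCLike.continuous_ofReal
    fun_prop
  have hconst : IsLocallyConstant fun t => (f t : X →ₗ[𝕜] X).index := by
    rw [IsLocallyConstant.iff_eventually_eq]
    intro t
    filter_upwards [hf.continuousAt.eventually (hR ((t : 𝕜) • S)).eventually_index_eq] with s hs
    exact hs.2
  have h := hconst.apply_eq_of_preconnectedSpace 1 0
  have h1 : f 1 = ContinuousLinearMap.id 𝕜 X - S ∘L R := by simp [f]
  have h0 : f 0 = ContinuousLinearMap.id 𝕜 X := by simp [f]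
  simp only [h1, h0] at h
  rw [h]
  exact LinearMap.index_id

/-- Fredholm operators and their index are stable under inessential perturbations. -/
theorem FredholmOfIndex.add_inessential [CompleteSpace X] {k : ℤ} {T R : X →L[𝕜] Y}
    (hT : T ∈ FredholmOfIndex 𝕜 X Y k) (hR : IsInessential R) :
    T + R ∈ FredholmOfIndex 𝕜 X Y k := by
  obtain ⟨P, hP⟩ := hT.1.exists_isQuasiInverse
  have hPF : P.IsFredholm := .of_isQuasiInverse hP.symm
  have hQ : ContinuousLinearMap.id 𝕜 X + P ∘L R =
      ContinuousLinearMap.id 𝕜 X - (-P) ∘L R := by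
    rw [ContinuousLinearMap.neg_comp, sub_neg_eq_add]
  have h1 : ((P ∘L (T + R) : X →L[𝕜] X) : X →ₗ[𝕜] X) ≈
      ((ContinuousLinearMap.id 𝕜 X - (-P) ∘L R : X →L[𝕜] X) : X →ₗ[𝕜] X) := by
    rw [← hQ]
    exact LinearMap.equiv_comp_add hP.1
  have hPT := (hR (-P)).of_equiv h1
  obtain ⟨w, hw⟩ := hPT.exists_isQuasiInverse
  -- Both `P` and `P(T + R)` are Fredholm, so `T + R` is too.
  have hTR : (T + R).IsFredholm :=
    .of_isQuasiInverse (v := w ∘L P) (LinearMap.IsQuasiInverse.of_comp_right hP.symm hw)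
  have h2 := (hR (-P)).index_eq_of_equiv h1
  rw [hR.index_id_sub_comp, hPF.index_comp hTR, hP.index_eq_neg, hT.2] at h2
  exact ⟨hTR, by lia⟩

/-- By completeness, Fredholmness is a matter of finite dimensions, which the algebraic isomorphisms
of kernels and cokernels transfer. -/
theorem FredholmOfIndex.id_sub_comp_comm [CompleteSpace X] [CompleteSpace Y] {k : ℤ}
    {S : Y →L[𝕜] X} {T : X →L[𝕜] Y}
    (h : ContinuousLinearMap.id 𝕜 X - S ∘L T ∈ FredholmOfIndex 𝕜 X X k) :
    ContinuousLinearMap.id 𝕜 Y - T ∘L S ∈ FredholmOfIndex 𝕜 Y Y k := by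
  refine ⟨(isFredholm_iff_finiteDimensional _).2 ?_, ?_⟩
  · obtain ⟨hk, hc⟩ := (isFredholm_iff_finiteDimensional _).1 h.1
    have : FiniteDimensional 𝕜
        (LinearMap.id - (S : Y →ₗ[𝕜] X) ∘ₗ (T : X →ₗ[𝕜] Y)).ker := hk
    have : FiniteDimensional 𝕜
        (X ⧸ (LinearMap.id - (S : Y →ₗ[𝕜] X) ∘ₗ (T : X →ₗ[𝕜] Y)).range) := hc
    exact ⟨Module.Finite.equiv (LinearMap.kerOneSubCompEquiv (S : Y →ₗ[𝕜] X) (T : X →ₗ[𝕜] Y)),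
      Module.Finite.equiv (LinearMap.cokerOneSubCompEquiv (S : Y →ₗ[𝕜] X) (T : X →ₗ[𝕜] Y))⟩
  · exact (LinearMap.index_one_sub_comp_comm (S : Y →ₗ[𝕜] X) (T : X →ₗ[𝕜] Y)).symm.trans h.2

theorem FredholmOfIndex.comp {j k : ℤ} {T : X →L[𝕜] Y} {U : Y →L[𝕜] Z}
    (hU : U ∈ FredholmOfIndex 𝕜 Y Z j) (hT : T ∈ FredholmOfIndex 𝕜 X Y k) :
    U ∘L T ∈ FredholmOfIndex 𝕜 X Z (j + k) :=
  ⟨hU.1.comp hT.1, by rw [hU.1.index_comp hT.1, hU.2, hT.2]⟩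

end Fredholm

/-! ### The group structure of the index set -/

section SchurIndexSet

variable {𝕜 X Y : Type*} [RCLike 𝕜] [NormedAddCommGroup X] [NormedSpace 𝕜 X]
  [NormedAddCommGroup Y] [NormedSpace 𝕜 Y]

theorem schurIndexSet_comm : schurIndexSet 𝕜 X Y = schurIndexSet 𝕜 Y X := by
  ext k
  constructor <;>
  · rintro ⟨⟨U, V⟩, hU, hV, A, D, B, C, h1, h2⟩
    exact ⟨⟨V, U⟩, hV, hU, D, A, C, B, h2, h1⟩

/-- Multiplying `U = A - B D⁻¹ C` by `A⁻¹` normalises it to `I - W`; conversely `I - ST` and `I -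
TS` are coupled with `A` and `D` the identities. -/
theorem mem_schurIndexSet_iff [CompleteSpace X] [CompleteSpace Y] {k : ℤ} :
    k ∈ schurIndexSet 𝕜 X Y ↔ ∃ W ∈ FactoringThrough 𝕜 Y X,
      ContinuousLinearMap.id 𝕜 X - W ∈ FredholmOfIndex 𝕜 X X k := by
  constructor
  · rintro ⟨⟨U, V⟩, hU, -, A, D, B, C, h1, -⟩
    refine ⟨((A.symm : X →L[𝕜] X) ∘L B) ∘L ((D.symm : Y →L[𝕜] Y) ∘L C), ⟨_, _, rfl⟩, ?_⟩
    have hA : (A.symm : X →L[𝕜] X) ∈ FredholmOfIndex 𝕜 X X 0 :=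
      ⟨A.symm.isFredholm, A.symm.index_eq_zero⟩
    have := FredholmOfIndex.comp hA hU
    rw [zero_add] at this
    convert this using 1
    ext x
    simp [show U = _ from h1]
  · rintro ⟨_, ⟨S, T, rfl⟩, h⟩
    exact ⟨⟨_, _⟩, h, FredholmOfIndex.id_sub_comp_comm h, .refl 𝕜 X, .refl 𝕜 Y, S, T, rfl, rfl⟩

theorem zero_mem_schurIndexSet [CompleteSpace X] [CompleteSpace Y] :
    0 ∈ schurIndexSet 𝕜 X Y := by
  refine mem_schurIndexSet_iff.2 ⟨0, ⟨0, 0, by simp⟩, ?_⟩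
  rw [sub_zero]
  exact ⟨(ContinuousLinearEquiv.refl 𝕜 X).isFredholm, LinearMap.index_id⟩

theorem neg_mem_schurIndexSet [CompleteSpace X] [CompleteSpace Y] {k : ℤ}
    (hk : k ∈ schurIndexSet 𝕜 X Y) : -k ∈ schurIndexSet 𝕜 X Y := by
  obtain ⟨_, ⟨S, T, rfl⟩, hF, hi⟩ := mem_schurIndexSet_iff.1 hk
  obtain ⟨P, hP⟩ := hF.exists_isQuasiInverse
  have hPF : P.IsFredholm := .of_isQuasiInverse hP.symm
  have h : ((ContinuousLinearMap.id 𝕜 X - (-(P ∘L S)) ∘L T : X →L[𝕜] X) : X →ₗ[𝕜] X) ≈ P := by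
    have := Setoid.symm hP.1.equiv
    rw [equiv_iff_hasNoetherianRange] at this ⊢
    convert this using 1
    ext x
    simp
    abel
  refine mem_schurIndexSet_iff.2 ⟨_, ⟨-(P ∘L S), T, rfl⟩, hPF.of_equiv h, ?_⟩
  rw [hPF.index_eq_of_equiv h, hP.index_eq_neg, hi]

theorem EssentiallyClosedUnderAddition.add_mem_schurIndexSet [CompleteSpace X] [CompleteSpace Y]
    (h : EssentiallyClosedUnderAddition (FactoringThrough 𝕜 Y X)) {j k : ℤ}
    (hj : j ∈ schurIndexSet 𝕜 X Y) (hk : k ∈ schurIndexSet 𝕜 X Y) :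
    j + k ∈ schurIndexSet 𝕜 X Y := by
  obtain ⟨_, ⟨S₁, T₁, rfl⟩, h₁⟩ := mem_schurIndexSet_iff.1 hj
  obtain ⟨W, hW, h₂⟩ := mem_schurIndexSet_iff.1 hk
  -- The two summands are those of `I - (I - S₁T₁)(I - W)`.
  obtain ⟨R, hR, hmem⟩ := h (S₁ ∘L (T₁ ∘L (ContinuousLinearMap.id 𝕜 X - W))) ⟨_, _, rfl⟩ W hW
  refine mem_schurIndexSet_iff.2 ⟨_, hmem, ?_⟩
  convert FredholmOfIndex.add_inessential (FredholmOfIndex.comp h₁ h₂) hR using 1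
  ext x
  simp
  abel

end SchurIndexSet

theorem proposition5p6 {𝕜 X Y : Type*} [RCLike 𝕜]
    [NormedAddCommGroup X] [NormedSpace 𝕜 X] [CompleteSpace X]
    [NormedAddCommGroup Y] [NormedSpace 𝕜 Y] [CompleteSpace Y]
    (h : EssentiallyClosedUnderAddition (FactoringThrough 𝕜 Y X) ∨
      EssentiallyClosedUnderAddition (FactoringThrough 𝕜 X Y)) :
    (∀ k₁ ∈ schurIndexSet 𝕜 X Y, ∀ k₂ ∈ schurIndexSet 𝕜 X Y,
      k₁ + k₂ ∈ schurIndexSet 𝕜 X Y) ∧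
    schurIndexSet 𝕜 X Y = {k : ℤ | ∃ m : ℤ, k = (schurIndex 𝕜 X Y : ℤ) * m} := by
  classical
  have hadd : ∀ k₁ ∈ schurIndexSet 𝕜 X Y, ∀ k₂ ∈ schurIndexSet 𝕜 X Y,
      k₁ + k₂ ∈ schurIndexSet 𝕜 X Y := by
    intro k₁ h₁ k₂ h₂
    rcases h with h | h
    · exact h.add_mem_schurIndexSet h₁ h₂
    · rw [schurIndexSet_comm] at h₁ h₂ ⊢
      exact h.add_mem_schurIndexSet h₁ h₂
  refine ⟨hadd, ?_⟩
  let G : AddSubgroup ℤ :=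
    { carrier := schurIndexSet 𝕜 X Y
      add_mem' := fun h₁ h₂ => hadd _ h₁ _ h₂
      zero_mem' := zero_mem_schurIndexSet
      neg_mem' := neg_mem_schurIndexSet }
  have hG : ∀ k, k ∈ schurIndexSet 𝕜 X Y ↔ k ∈ G := fun _ => Iff.rfl
  ext k
  simp only [Set.mem_ofPred_eq, schurIndex]
  split_ifs with hex
  · obtain ⟨hpos, hmem⟩ := Nat.find_spec hex
    have hmin : ∀ n : ℕ, n < Nat.find hex → ¬(0 < n ∧ (n : ℤ) ∈ schurIndexSet 𝕜 X Y) :=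
      fun n => Nat.find_min hex
    generalize Nat.find hex = n at hpos hmem hmin
    have hmul : ∀ m : ℤ, (n : ℤ) * m ∈ G := fun m => by
      simpa [mul_comm] using G.zsmul_mem ((hG _).1 hmem) m
    constructor
    · intro hk
      have hn : (0 : ℤ) < n := by exact_mod_cast hpos
      -- Division with remainder: a nonzero remainder would be a smaller positive element.
      have hr : k % n ∈ G := by
        rw [Int.emod_def]
        exact G.sub_mem hk (hmul _)
      have h0 := Int.emod_nonneg k hn.ne'
      have hlt := Int.emod_lt_of_pos k hn
      obtain ⟨r, hr'⟩ := Int.eq_ofNat_of_zero_le h0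
      have hz : r = 0 := by
        by_contra hne
        exact hmin r (by lia) ⟨Nat.pos_of_ne_zero hne, by rw [hG, ← hr']; exact hr⟩
      exact Int.dvd_of_emod_eq_zero (by simp [hr', hz])
    · rintro ⟨m, rfl⟩
      exact hmul m
  · constructor
    · intro hk
      -- Here `schurIndex` takes its default `0`, so `k = 0` is needed; otherwise `|k|` would be a
      -- positive element.
      refine ⟨0, ?_⟩
      by_contra hne
      refine hex ⟨k.natAbs, by lia, ?_⟩
      rcases Int.natAbs_eq k with h' | h'
      · rwa [← h']
      · have := G.neg_mem ((hG _).1 hk)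
        rw [hG]
        convert this using 1
        lia
    · rintro ⟨m, rfl⟩
      simpa using zero_mem_schurIndexSet
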